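/- Let $p$ be a prime, let $n,k$ be positive integers, and put $d=\gcd(n,k)$, $m=n/d$, $q=p^k$, $Q=p^n$. All finite fields are taken inside a fixed algebraic closure of $\mathbb{F}_p$. Let $a\in\mathbb{F}_Q^*$ and $P_a(X)=X^{q+1}+X+a$. Define polynomials $A_r(X)\in\mathbb{F}_p[X]$, $r\ge 1$, by $$A_1=1,\quad A_2=-1,\quad A_{r+2}(X)=-A_{r+1}(X)^q-X^qA_r(X)^{q^2}\quad(r\ge 1),$$ and $B_r(X)$, $r\ge1$, by $B_1=0$, $B_{r+1}(X)=-a\,A_r(X)^q$. Put $$N=m(p^d-1),\qquad s=\frac{(q^m-1)(p^d-1)}{(Q-1)(q-1)}$$ ($s$ is an integer), $$G_1(X)=\sum_{i=0}^{m-2}A_{m-1-i}(a)^{q^{i+1}}X^{q^i},\qquad G_2(X)=\sum_{i=0}^{p^d-2}B_m(a)^{p^d-2-i}X^{q^{mi}},$$ and let $$M=\left\{G_1\big(G_2(y)^s\,u\,v\big)^{q-1} : y\in\mathbb{F}_{q^N}^*,\ u\in\mathbb{F}_q^*,\ v\in\mathbb{F}_Q^*\right\}.$$ Assume $A_m(a)=0$.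 Then $P_a$ has exactly $p^d+1$ roots in $\mathbb{F}_Q$, and $M$ contains a nonzero element. Moreover, for every nonzero $x_0\in M$ the following hold. 1. $x_0\in\mathbb{F}_Q$ and $P_a(x_0)=0$. 2. There is $\beta\in\mathbb{F}_Q$ with $\beta^{q-1}=x_0^2/a$. 3. For every $\beta\in\mathbb{F}_Q$ with $\beta^{q-1}=x_0^2/a$, the equation $w^q-w+\frac{1}{\beta x_0}=0$ has exactly $p^d$ solutions in $\mathbb{F}_Q$; and for each solution $w_0\in\mathbb{F}_Q$ of it, the set of roots of $P_a$ in $\mathbb{F}_Q$ is $\{x_0\}\cup\{(w_0+\alpha)^{q-1}x_0 : \alpha\in\mathbb{F}_{p^d}\}$. -/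

import Mathlib

open Polynomial

noncomputable section

namespace BluherEq

/-- A fixed algebraic closure of the prime field with `p` elements; all finite fields of
characteristic `p` are taken inside it. -/
abbrev Fbar (p : ℕ) [Fact p.Prime] : Type := AlgebraicClosure (ZMod p)

/-- For `l ≥ 1`, the subfield with `p ^ l` elements of the algebraic closure: the elements fixed by
the `l`-th power of the Frobenius map. -/
def GF (p : ℕ) [Fact p.Prime] (l : ℕ) : Subfield (Fbar p) :=
  RingHom.eqLocusField (iterateFrobenius (Fbar p) p l) (RingHom.id (Fbar p))

theorem mem_GF {p : ℕ} [Fact p.Prime] {l : ℕ} {x : Fbar p} : x ∈ GF p l ↔ x ^ p ^ l = x :=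
  Iff.rfl

/-- The sequence `A_r` of polynomials over the prime field, for `r ≥ 1` (index `0` is a
placeholder that the other values do not use). -/
def A (p q : ℕ) : ℕ → (ZMod p)[X]
  | 0 => 0
  | 1 => 1
  | 2 => -1
  | (r + 3) => -(A p q (r + 2)) ^ q - X ^ q * (A p q (r + 1)) ^ q ^ 2

/-- The value `A_r(a)`. -/
def Aval (p : ℕ) [Fact p.Prime] (q : ℕ) (a : Fbar p) (r : ℕ) : Fbar p :=
  aeval a (A p q r)

/-- The sequence `B_r` of polynomials, for `r ≥ 1`: `B_1 = 0` and `B_{r+1}(X) = -a * A_r(X)^q`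
(index `0` is a placeholder). -/
def B (p : ℕ) [Fact p.Prime] (q : ℕ) (a : Fbar p) : ℕ → (Fbar p)[X]
  | 0 => 0
  | 1 => 0
  | (r + 2) => -C a * ((A p q (r + 1)).map (algebraMap (ZMod p) (Fbar p))) ^ q

/-- The value `B_r(a)`. -/
def Bval (p : ℕ) [Fact p.Prime] (q : ℕ) (a : Fbar p) (r : ℕ) : Fbar p :=
  (B p q a r).eval a

/-- `P_a(X) = X^(q+1) + X + a`. -/
def P {p : ℕ} [Fact p.Prime] (q : ℕ) (a : Fbar p) : (Fbar p)[X] :=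
  X ^ (q + 1) + X + C a

/-- `G_1(X) = ∑_{i=0}^{m-2} A_{m-1-i}(a)^(q^(i+1)) X^(q^i)`. -/
def G₁ (p : ℕ) [Fact p.Prime] (q m : ℕ) (a : Fbar p) : (Fbar p)[X] :=
  ∑ i ∈ Finset.range (m - 1), C (Aval p q a (m - 1 - i) ^ q ^ (i + 1)) * X ^ q ^ i

/-- `G_2(X) = ∑_{i=0}^{p^d-2} B_m(a)^(p^d-2-i) X^(q^(m i))`. -/
def G₂ (p : ℕ) [Fact p.Prime] (q d m : ℕ) (a : Fbar p) : (Fbar p)[X] :=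
  ∑ i ∈ Finset.range (p ^ d - 1), C (Bval p q a m ^ (p ^ d - 2 - i)) * X ^ q ^ (m * i)

/-- `s = (q^m - 1)(p^d - 1) / ((Q - 1)(q - 1))` with `q = p^k`, `Q = p^n`, `d = gcd(n, k)`,
`m = n / d`. The division is exact, see `sExp_exact`. -/
def sExp (p n k : ℕ) : ℕ :=
  (((p ^ k) ^ (n / n.gcd k) - 1) * (p ^ n.gcd k - 1)) / ((p ^ n - 1) * (p ^ k - 1))

theorem sExp_exact (p n k : ℕ) :
    (p ^ n - 1) * (p ^ k - 1) ∣ ((p ^ k) ^ (n / n.gcd k) - 1) * (p ^ n.gcd k - 1) := by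
  have hg : (p ^ n - 1).gcd (p ^ k - 1) = p ^ n.gcd k - 1 :=
    Nat.pow_sub_one_gcd_pow_sub_one p n k
  rw [← hg, ← Nat.gcd_mul_lcm, mul_comm]
  refine Nat.mul_dvd_mul_right (Nat.lcm_dvd ?_ ?_) _
  · rw [← pow_mul]
    have h : n ∣ k * (n / n.gcd k) := by
      rw [← Nat.mul_div_assoc _ (Nat.gcd_dvd_left n k), mul_comm k n,
        Nat.mul_div_assoc _ (Nat.gcd_dvd_right n k)]
      exact dvd_mul_right _ _
    exact Nat.pow_sub_one_dvd_pow_sub_one p h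
  · simpa using Nat.sub_dvd_pow_sub_pow (p ^ k) 1 (n / n.gcd k)

/-- The set `G_1(G_2(F_{q^N}^*)^s · F_q^* · F_Q^*)^(q-1)` with `q = p^k`, `Q = p^n`,
`d = gcd(n, k)`, `m = n / d`, `N = m (p^d - 1)`; note that `q ^ N = p ^ (k * N)`. -/
def rootSource (p : ℕ) [Fact p.Prime] (n k : ℕ) (a : Fbar p) : Set (Fbar p) :=
  let q := p ^ k
  let d := n.gcd k
  let m := n / d
  let N := m * (p ^ d - 1)
  {x | ∃ y ∈ GF p (k * N), y ≠ 0 ∧ ∃ u ∈ GF p k, u ≠ 0 ∧ ∃ v ∈ GF p n, v ≠ 0 ∧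
    x = ((G₁ p q m a).eval (((G₂ p q d m a).eval y) ^ sExp p n k * u * v)) ^ (q - 1)}

/-- The set of roots of `P_a` in `F_Q`, `Q = p^n`. -/
def rootsIn {p : ℕ} [Fact p.Prime] (n q : ℕ) (a : Fbar p) : Set (Fbar p) :=
  {x | x ∈ GF p n ∧ (P q a).IsRoot x}

end BluherEq

end

namespace BluherEq

/-! ### Arithmetic of the exponent `sExp` -/

/-! Write `L z = z ^ q ^ 2 + z ^ q + a z` (`lin`). For nonzero `z`, `L z = 0` exactly when `z ^ (q -
1)` is a root of `P_a`, so roots correspond to `F_q`-lines in `ker L`. The recurrences give `G₁ (L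
z) = z ^ q ^ m - A_m z ^ q - B_m z` (`G₁_eval_lin`). When `A_m = 0`, the map `z ↦ z ^ q ^ m` is
therefore multiplication by `b = B_m` on `ker L`, and `b` lies in `F_q` (`Bval_pow_eq_self`). Since
`L` is surjective and commutes with both maps, also `L (G₁ T) = T ^ q ^ m - b T` (`lin_G₁_eval`).

Values `t` of `G₂` on `F_{q^N}` satisfy `t ^ q ^ m = b t`. For `T = t ^ s u v` this relation
persists because `s ≡ 1` modulo `p ^ d - 1`, while the exact value of `s` gives `T ^ Q = e T` with
`e` in `F_q`. Hence `z = G₁ T` is in `ker L` and `z ^ (q - 1)` is in `F_Q` (`rootSource_subset`).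
Nonvanishing for suitable parameters is Dedekind independence of characters (`exists_sum_ne_zero`).

Given a root `x₀ = z ^ (q - 1)`, put `D = w ^ q - w`. Then `w z` is in `ker L` iff `x₀ ^ (q + 1) D ^
q = a D`, an equation solved by `D = -1 / (β x₀)`. As `b` is the same scalar for `z` and `w z`,
every such `w` is fixed by `w ↦ w ^ q ^ m`, and Hilbert 90 moves `β` and `w` into `F_Q`. The other
roots come from the solutions `w₀ + α`. -/

theorem geom_sum_mul_index {R : Type*} [CommRing R] (x : R) (m l : ℕ) :
    ∑ i ∈ Finset.range (m * l), x ^ i =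
      (∑ i ∈ Finset.range m, x ^ i) * ∑ j ∈ Finset.range l, (x ^ m) ^ j := by
  induction l with
  | zero => simp
  | succ l ih =>
    rw [Nat.mul_succ, Finset.sum_range_add, ih, Finset.sum_range_succ, mul_add, add_right_inj,
      Finset.sum_mul]
    exact Finset.sum_congr rfl fun i _ => by rw [pow_add, pow_mul, mul_comm]

/-- The Euclidean algorithm on the lengths `m`, `l` lifts to the geometric sums: reducing `l` modulo
`m` changes the sum by a multiple of the other one. -/
theorem isCoprime_geom_sum {R : Type*} [CommRing R] (x : R) (m l : ℕ) :
    m.Coprime l → IsCoprime (∑ i ∈ Finset.range m, x ^ i) (∑ i ∈ Finset.range l, x ^ i) := by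
  induction m, l using Nat.gcd.induction with
  | H0 l =>
    intro h
    rw [Nat.coprime_zero_left] at h
    subst h
    simp [isCoprime_one_right]
  | H1 m l hm ih =>
    intro h
    have h' : (l % m).Coprime m := by
      rw [Nat.Coprime, ← Nat.gcd_rec]; exact h
    have key : ∑ i ∈ Finset.range l, x ^ i = ∑ i ∈ Finset.range (l % m), x ^ i +
        (∑ i ∈ Finset.range m, x ^ i) *
          (x ^ (l % m) * ∑ j ∈ Finset.range (l / m), (x ^ m) ^ j) := by
      conv_lhs => rw [← Nat.mod_add_div l m]
      rw [Finset.sum_range_add, mul_left_comm, ← geom_sum_mul_index, Finset.mul_sum]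
      simp only [pow_add]
    rw [key]
    exact (ih h').symm.add_mul_left_right _

theorem exists_pow_sub_one_factor {m l : ℕ} (hm : 0 < m) (hl : 0 < l) (h : m.Coprime l) (x : ℤ) :
    ∃ c : ℤ, x - 1 ∣ c - 1 ∧
      (x ^ (m * l) - 1) * (x - 1) = (x ^ m - 1) * (x ^ l - 1) * c := by
  have hdvd : (∑ i ∈ Finset.range m, (X : ℤ[X]) ^ i) * (∑ i ∈ Finset.range l, (X : ℤ[X]) ^ i) ∣
      ∑ i ∈ Finset.range (m * l), (X : ℤ[X]) ^ i := by
    refine (isCoprime_geom_sum X m l h).mul_dvd ⟨_, geom_sum_mul_index X m l⟩ ?_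
    rw [mul_comm m l]
    exact ⟨_, geom_sum_mul_index X l m⟩
  obtain ⟨S, hS⟩ := hdvd
  have hev (y : ℤ) := congrArg (eval y) hS
  simp only [eval_mul, eval_finsetSum, eval_pow, eval_X] at hev
  refine ⟨S.eval x, ?_, ?_⟩
  -- At `1` the polynomial identity reads `m l = m l S(1)`; working over `ℤ[X]` is what makes this
  -- specialization available.
  · have h1 : S.eval 1 = 1 := by
      have := hev 1
      simp only [one_pow, Finset.sum_const, Finset.card_range, nsmul_eq_mul, mul_one,
        Nat.cast_mul] at this
      have hne : (m : ℤ) * l ≠ 0 := by positivity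
      exact mul_left_cancel₀ hne (by rw [← this, mul_one])
    simpa [h1] using sub_dvd_eval_sub x 1 S
  · rw [← mul_geom_sum x (m * l), ← mul_geom_sum x m, ← mul_geom_sum x l, hev x]
    ring

theorem sExp_mul {p n k : ℕ} :
    sExp p n k * ((p ^ n - 1) * (p ^ k - 1)) =
      ((p ^ k) ^ (n / n.gcd k) - 1) * (p ^ n.gcd k - 1) :=
  Nat.div_mul_cancel (sExp_exact p n k)

/-- `s` is the cofactor `c` of `exists_pow_sub_one_factor` at `x = p ^ d`. The congruence lets `t ^
s` be scaled by `b` whenever `t` is, as `b ^ (p ^ d - 1) = 1`. -/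
theorem exists_sExp_eq {p n k : ℕ} (hp : 1 < p) (hn : 0 < n) (hk : 0 < k) :
    ∃ t, sExp p n k = (p ^ n.gcd k - 1) * t + 1 := by
  have hs := sExp_mul (p := p) (n := n) (k := k)
  obtain ⟨d, m, l, hd, hml, rfl, rfl⟩ :
      ∃ d m l, 0 < d ∧ m.Coprime l ∧ n = d * m ∧ k = d * l := by
    refine ⟨n.gcd k, n / n.gcd k, k / n.gcd k, Nat.gcd_pos_of_pos_left _ hn, ?_, ?_, ?_⟩
    · exact Nat.coprime_div_gcd_div_gcd (Nat.gcd_pos_of_pos_left _ hn)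
    · exact (Nat.mul_div_cancel' (Nat.gcd_dvd_left _ _)).symm
    · exact (Nat.mul_div_cancel' (Nat.gcd_dvd_right _ _)).symm
  have hg : (d * m).gcd (d * l) = d := by rw [Nat.gcd_mul_left, hml.gcd_eq_one, mul_one]
  have hm : 0 < m := Nat.pos_of_mul_pos_left hn
  have hl : 0 < l := Nat.pos_of_mul_pos_left hk
  rw [hg, Nat.mul_div_cancel_left m hd] at hs
  rw [hg]
  have hpos (j : ℕ) : 1 ≤ p ^ j := Nat.one_le_pow _ _ (by omega)
  have hgt (j : ℕ) (hj : 0 < j) : 1 < p ^ j := Nat.one_lt_pow hj.ne' hp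
  obtain ⟨c, hc, hcs⟩ := exists_pow_sub_one_factor hm hl hml ((p : ℤ) ^ d)
  have hcast : ∀ j, ((p ^ j - 1 : ℕ) : ℤ) = (p : ℤ) ^ j - 1 := fun j => by
    rw [Nat.cast_sub (hpos j)]; simp
  have hsc : (sExp p (d * m) (d * l) : ℤ) = c := by
    have h1 := congrArg (Nat.cast : ℕ → ℤ) hs
    rw [← pow_mul] at h1
    simp only [Nat.cast_mul, hcast] at h1
    rw [← pow_mul, ← pow_mul, ← pow_mul, show d * (m * l) = d * l * m by ring, ← h1, mul_comm] at hcs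
    have hne (j : ℕ) (hj : 0 < j) : (p : ℤ) ^ j - 1 ≠ 0 := by
      rw [← hcast]
      have := hgt j hj
      exact_mod_cast (by omega : p ^ j - 1 ≠ 0)
    exact mul_left_cancel₀ (mul_ne_zero (hne _ hn) (hne _ hk)) hcs
  have hspos : 1 ≤ sExp p (d * m) (d * l) := by
    rw [Nat.one_le_iff_ne_zero]
    intro h0
    rw [h0, zero_mul, ← pow_mul] at hs
    have h1 := hgt (d * l * m) (by positivity)
    have h2 := hgt d hd
    have := Nat.mul_pos (Nat.sub_pos_of_lt h1) (Nat.sub_pos_of_lt h2)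
    omega
  rw [← hsc, ← hcast, show (1 : ℤ) = ((1 : ℕ) : ℤ) by simp, ← Nat.cast_sub hspos,
    Int.natCast_dvd_natCast] at hc
  obtain ⟨t, ht⟩ := hc
  exact ⟨t, by omega⟩

/-! ### The subfields `GF p l` -/

section GF

variable {p : ℕ} [Fact p.Prime]

theorem mem_GF_iff_isPeriodicPt {l : ℕ} {x : Fbar p} :
    x ∈ GF p l ↔ Function.IsPeriodicPt (frobenius (Fbar p) p) l x := by
  rw [mem_GF, Function.IsPeriodicPt, Function.IsFixedPt, iterate_frobenius]

theorem GF_le_of_dvd {l l' : ℕ} (h : l ∣ l') : GF p l ≤ GF p l' := fun _ hx =>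
  mem_GF_iff_isPeriodicPt.2 ((mem_GF_iff_isPeriodicPt.1 hx).trans_dvd h)

theorem mem_GF_gcd {l l' : ℕ} {x : Fbar p} (h : x ∈ GF p l) (h' : x ∈ GF p l') :
    x ∈ GF p (l.gcd l') :=
  mem_GF_iff_isPeriodicPt.2
    ((mem_GF_iff_isPeriodicPt.1 h).gcd (mem_GF_iff_isPeriodicPt.1 h'))

theorem ncard_GF {l : ℕ} (hl : 0 < l) : (GF p l : Set (Fbar p)).ncard = p ^ l := by
  have hp : 1 < p := (Fact.out : p.Prime).one_lt
  have hdeg := FiniteField.X_pow_card_pow_sub_X_natDegree_eq (Fbar p) hl.ne' hp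
  have hne : (X ^ p ^ l - X : (Fbar p)[X]) ≠ 0 :=
    FiniteField.X_pow_card_pow_sub_X_ne_zero (Fbar p) hl.ne' hp
  have hset : (GF p l : Set (Fbar p)) = (X ^ p ^ l - X : (Fbar p)[X]).rootSet (Fbar p) := by
    ext x
    rw [mem_rootSet_of_ne hne]
    simp [mem_GF, sub_eq_zero]
  rw [hset, ← Nat.card_coe_set_eq, Nat.card_eq_fintype_card,
    card_rootSet_eq_natDegree (galois_poly_separable p _ (dvd_pow_self p hl.ne'))
      (IsAlgClosed.splits _), hdeg]

theorem finite_GF {l : ℕ} (hl : 0 < l) : (GF p l : Set (Fbar p)).Finite :=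
  Set.finite_of_ncard_pos (by
    rw [ncard_GF hl]; exact pow_pos (Fact.out : p.Prime).pos l)

theorem dvd_of_GF_le {l l' : ℕ} (hl : 0 < l) (h : GF p l ≤ GF p l') : l ∣ l' := by
  have hg : 0 < l.gcd l' := Nat.gcd_pos_of_pos_left _ hl
  have hle : GF p l ≤ GF p (l.gcd l') := fun x hx => mem_GF_gcd hx (h hx)
  have hcard := Set.ncard_le_ncard (s := (GF p l : Set (Fbar p))) hle (finite_GF hg)
  rw [ncard_GF hl, ncard_GF hg] at hcard
  have := (Nat.pow_le_pow_iff_right (Fact.out : p.Prime).one_lt).1 hcard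
  have h2 := Nat.gcd_le_left l' hl
  exact Nat.gcd_eq_left_iff_dvd.1 (le_antisymm h2 this)

/-- The powers `x ↦ x ^ (p ^ k) ^ i`, `i < n / gcd n k`, are linearly independent on `GF p n`. -/
theorem exists_sum_ne_zero {n k r : ℕ} (hn : 0 < n) (hr : r ≤ n / n.gcd k)
    (c : ℕ → Fbar p) {j : ℕ} (hj : j < r) (hc : c j ≠ 0) :
    ∃ v ∈ GF p n, ∑ i ∈ Finset.range r, c i * v ^ (p ^ k) ^ i ≠ 0 := by
  -- Dedekind's theorem applies once the characters are distinct: if two agree, `F_{p^n}` lies in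
  -- `F_{p^(k (i' - i))}`, forcing `n / gcd n k` to divide `i' - i`.
  by_contra! hzero
  let f : Fin r → (GF p n →* Fbar p) := fun i =>
    (powMonoidHom ((p ^ k) ^ (i : ℕ))).comp (GF p n).subtype.toMonoidHom
  have hlt : ∀ {i i' : Fin r}, i < i' → f i ≠ f i' := by
    intro i i' hii h
    have hii : (i : ℕ) < i' := hii
    have hle : GF p n ≤ GF p (k * (i' - i : ℕ)) := by
      intro x hx
      have hx' : x ^ (p ^ k) ^ (i : ℕ) = x ^ (p ^ k) ^ (i' : ℕ) := by
        simpa [f] using DFunLike.congr_fun h ⟨x, hx⟩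
      rw [mem_GF]
      rw [← Nat.sub_add_cancel hii.le, pow_add, pow_mul, ← pow_mul, ← pow_mul] at hx'
      apply iterateFrobenius_inj (Fbar p) p (k * (i : ℕ))
      rw [iterateFrobenius_def, iterateFrobenius_def, hx', pow_mul p k (i' - i : ℕ), ← pow_mul x]
    have hdvd := dvd_of_GF_le hn hle
    have hg : 0 < n.gcd k := Nat.gcd_pos_of_pos_left _ hn
    have h1 : n / n.gcd k ∣ k / n.gcd k * (i' - i : ℕ) := by
      apply Nat.dvd_of_mul_dvd_mul_left hg
      rw [← mul_assoc, Nat.mul_div_cancel' (Nat.gcd_dvd_left n k),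
        Nat.mul_div_cancel' (Nat.gcd_dvd_right n k)]
      exact hdvd
    have h2 := (Nat.coprime_div_gcd_div_gcd hg).dvd_of_dvd_mul_left h1
    have h3 := Nat.le_of_dvd (by omega) h2
    have := i'.2
    omega
  have hinj : Function.Injective f := by
    intro i i' h
    rcases lt_trichotomy i i' with h1 | h1 | h1
    · exact (hlt h1 h).elim
    · exact h1
    · exact (hlt h1 h.symm).elim
  have hli := (linearIndependent_monoidHom (GF p n) (Fbar p)).comp f hinj
  rw [Fintype.linearIndependent_iff] at hli
  refine hc (hli (fun i => c i) ?_ ⟨j, hj⟩)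
  ext x
  have := hzero x x.2
  rw [← Fin.sum_univ_eq_sum_range (fun i => c i * (x : Fbar p) ^ (p ^ k) ^ i)] at this
  simpa [f] using this

end GF

/-! ### The linearized polynomial attached to `P_a` -/

section Linearized

variable {p : ℕ} [Fact p.Prime]

theorem add_pow_frob (x y : Fbar p) (k i : ℕ) :
    (x + y) ^ (p ^ k) ^ i = x ^ (p ^ k) ^ i + y ^ (p ^ k) ^ i := by
  rw [← pow_mul, add_pow_expChar_pow]

theorem sub_pow_frob (x y : Fbar p) (k i : ℕ) :
    (x - y) ^ (p ^ k) ^ i = x ^ (p ^ k) ^ i - y ^ (p ^ k) ^ i := by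
  rw [← pow_mul, sub_pow_expChar_pow]

theorem neg_pow_frob (x : Fbar p) (k : ℕ) : (-x) ^ p ^ k = -x ^ p ^ k := by
  have h := sub_pow_expChar_pow (0 : Fbar p) x k (p := p)
  rwa [zero_sub, zero_pow (pow_ne_zero _ (Fact.out : p.Prime).ne_zero), zero_sub] at h

theorem pow_frob_succ (x : Fbar p) (q i : ℕ) : (x ^ q ^ i) ^ q = x ^ q ^ (i + 1) := by
  rw [← pow_mul, ← pow_succ]

/-- `z ^ q ^ 2 + z ^ q + a z`; for `z ≠ 0` it vanishes exactly when `z ^ (q - 1)` is a root of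
`P_a`. -/
noncomputable def lin (q : ℕ) (a z : Fbar p) : Fbar p := z ^ q ^ 2 + z ^ q + a * z

theorem lin_sub (k : ℕ) (a y z : Fbar p) :
    lin (p ^ k) a (y - z) = lin (p ^ k) a y - lin (p ^ k) a z := by
  simp only [lin, sub_pow_frob, sub_pow_expChar_pow]
  ring

theorem lin_pow_frob (k : ℕ) {i : ℕ} {a : Fbar p} (ha : a ^ (p ^ k) ^ i = a) (z : Fbar p) :
    lin (p ^ k) a (z ^ (p ^ k) ^ i) = lin (p ^ k) a z ^ (p ^ k) ^ i := by
  rw [lin, lin, add_pow_frob, add_pow_frob, mul_pow, ha, pow_right_comm z _ (_ ^ 2),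
    pow_right_comm z _ (p ^ k)]

theorem lin_mul_of_pow_eq_self (k : ℕ) (a : Fbar p) {b : Fbar p} (hb : b ^ p ^ k = b)
    (z : Fbar p) : lin (p ^ k) a (b * z) = b * lin (p ^ k) a z := by
  have hb2 : b ^ (p ^ k) ^ 2 = b := by rw [pow_two, pow_mul, hb, hb]
  simp only [lin, mul_pow, hb, hb2]
  ring

theorem lin_mul {k : ℕ} {a x z : Fbar p} (hx : x ^ (p ^ k + 1) + x + a = 0)
    (hz : z ^ p ^ k = x * z) (w : Fbar p) :
    lin (p ^ k) a (w * z) =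
      z * (x ^ (p ^ k + 1) * (w ^ p ^ k - w) ^ p ^ k - a * (w ^ p ^ k - w)) := by
  have hz2 : z ^ (p ^ k) ^ 2 = x ^ (p ^ k + 1) * z := by
    rw [pow_two, pow_mul, hz, mul_pow, hz, pow_succ]; ring
  have hw : (w ^ p ^ k - w) ^ p ^ k = w ^ (p ^ k) ^ 2 - w ^ p ^ k := by
    rw [sub_pow_expChar_pow, ← pow_mul, ← pow_two]
  rw [lin, mul_pow, mul_pow, hz, hz2, hw]
  linear_combination (z * w ^ p ^ k) * hx

theorem lin_eq_zero {k : ℕ} {a x z : Fbar p} (hx : x ^ (p ^ k + 1) + x + a = 0)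
    (hz : z ^ p ^ k = x * z) : lin (p ^ k) a z = 0 := by
  have hq : p ^ k ≠ 0 := pow_ne_zero _ (Fact.out : p.Prime).ne_zero
  have h := lin_mul hx hz 1
  rwa [one_mul, one_pow, sub_self, zero_pow hq, mul_zero, mul_zero, sub_zero, mul_zero] at h

theorem root_of_lin_eq_zero {q : ℕ} {a x z : Fbar p} (hz0 : z ≠ 0) (hz : z ^ q = x * z)
    (h : lin q a z = 0) : x ^ (q + 1) + x + a = 0 := by
  rw [lin, pow_two, pow_mul, hz, mul_pow, hz] at h
  apply mul_right_cancel₀ hz0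
  linear_combination h

theorem lin_surjective {k : ℕ} (hk : 0 < k) (a : Fbar p) :
    Function.Surjective (lin (p ^ k) a) := by
  intro y
  have hq : 1 < p ^ k := Nat.one_lt_pow hk.ne' (Fact.out : p.Prime).one_lt
  have hq2 : p ^ k < (p ^ k) ^ 2 := by nlinarith
  have hdeg : (X ^ (p ^ k) ^ 2 + (X ^ p ^ k + (C a * X + C (-y))) : (Fbar p)[X]).degree
      = ((p ^ k) ^ 2 : ℕ) := by
    have h1 : (C a * X + C (-y) : (Fbar p)[X]).degree ≤ 1 := degree_linear_le
    have h2 : (X ^ p ^ k + (C a * X + C (-y)) : (Fbar p)[X]).degree ≤ (p ^ k : ℕ) := by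
      refine (degree_add_le _ _).trans (max_le (by simp) (h1.trans ?_))
      exact_mod_cast hq.le
    rw [degree_add_eq_left_of_degree_lt, degree_X_pow]
    rw [degree_X_pow]
    exact h2.trans_lt (by exact_mod_cast hq2)
  obtain ⟨z, hz⟩ := IsAlgClosed.exists_root _ (by
    rw [hdeg]; exact_mod_cast (by positivity : (p ^ k) ^ 2 ≠ 0))
  refine ⟨z, ?_⟩
  simp only [IsRoot.def, eval_add, eval_pow, eval_X, eval_mul, eval_C] at hz
  rw [lin]
  linear_combination hz

theorem exists_root_P {k : ℕ} (hk : 0 < k) {a : Fbar p} (ha0 : a ≠ 0) :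
    ∃ x, x ≠ 0 ∧ x ^ (p ^ k + 1) + x + a = 0 := by
  have hq : 1 < p ^ k := Nat.one_lt_pow hk.ne' (Fact.out : p.Prime).one_lt
  have hdeg : (X ^ (p ^ k + 1) + (X + C a) : (Fbar p)[X]).degree = (p ^ k + 1 : ℕ) := by
    rw [degree_add_eq_left_of_degree_lt, degree_X_pow]
    rw [degree_X_pow, degree_X_add_C]
    exact_mod_cast (by omega : 1 < p ^ k + 1)
  obtain ⟨x, hx⟩ := IsAlgClosed.exists_root _ (by
    rw [hdeg]; exact_mod_cast (by omega : p ^ k + 1 ≠ 0))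
  simp only [IsRoot.def, eval_add, eval_pow, eval_X, eval_C] at hx
  refine ⟨x, ?_, by rw [add_assoc]; exact hx⟩
  rintro rfl
  simp [ha0] at hx

theorem exists_pow_eq_mul {k : ℕ} (hk : 0 < k) {x : Fbar p} (hx0 : x ≠ 0) :
    ∃ z, z ≠ 0 ∧ z ^ p ^ k = x * z := by
  have hq : 1 < p ^ k := Nat.one_lt_pow hk.ne' (Fact.out : p.Prime).one_lt
  obtain ⟨z, hz⟩ := IsAlgClosed.exists_pow_nat_eq x (Nat.sub_pos_of_lt hq)
  refine ⟨z, ?_, ?_⟩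
  · rintro rfl
    exact hx0 (by rw [← hz, zero_pow (by omega)])
  · rw [← hz, ← pow_succ, Nat.sub_add_cancel hq.le]

theorem exists_pow_sub_eq {k : ℕ} (hk : 0 < k) (D : Fbar p) : ∃ w, w ^ p ^ k - w = D := by
  have hq : 1 < p ^ k := Nat.one_lt_pow hk.ne' (Fact.out : p.Prime).one_lt
  have hdeg : (X ^ p ^ k - (X + C D) : (Fbar p)[X]).degree = (p ^ k : ℕ) := by
    rw [degree_sub_eq_left_of_degree_lt, degree_X_pow]
    rw [degree_X_pow, degree_X_add_C]
    exact_mod_cast hq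
  obtain ⟨x, hx⟩ := IsAlgClosed.exists_root _ (by
    rw [hdeg]; exact_mod_cast (by omega : p ^ k ≠ 0))
  simp only [IsRoot.def, eval_add, eval_sub, eval_pow, eval_X, eval_C] at hx
  exact ⟨x, by linear_combination hx⟩

theorem exists_artinSchreier_datum {k : ℕ} (hk : 0 < k) {a x : Fbar p} (ha0 : a ≠ 0)
    (hx0 : x ≠ 0) : ∃ D, D ≠ 0 ∧ x ^ (p ^ k + 1) * D ^ p ^ k = a * D := by
  have hxq : x ^ (p ^ k + 1) ≠ 0 := pow_ne_zero _ hx0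
  obtain ⟨D, hD0, hD⟩ := exists_pow_eq_mul hk (div_ne_zero ha0 hxq)
  exact ⟨D, hD0, by rw [hD]; field_simp⟩

/-! ### Recurrences -/

theorem Aval_one (q : ℕ) (a : Fbar p) : Aval p q a 1 = 1 := by simp [Aval, A]

theorem Bval_one (q : ℕ) (a : Fbar p) : Bval p q a 1 = 0 := by simp [Bval, B]

theorem Bval_succ (q : ℕ) (a : Fbar p) (r : ℕ) :
    Bval p q a (r + 2) = -a * Aval p q a (r + 1) ^ q := by
  simp [Bval, Aval, B]

theorem Aval_succ (k : ℕ) (a : Fbar p) (r : ℕ) :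
    Aval p (p ^ k) a (r + 2) =
      Bval p (p ^ k) a (r + 1) ^ p ^ k - Aval p (p ^ k) a (r + 1) ^ p ^ k := by
  have hq : p ^ k ≠ 0 := pow_ne_zero _ (Fact.out : p.Prime).ne_zero
  cases r with
  | zero =>
    rw [zero_add, Bval_one, Aval_one, zero_pow hq, one_pow, zero_sub]
    simp [Aval, A]
  | succ r =>
    rw [Bval_succ, neg_mul, neg_pow_frob, mul_pow, ← pow_mul, ← pow_two]
    simp only [Aval, A, map_sub, map_neg, map_mul, map_pow, aeval_X]
    ring

theorem G₁_eval_one (q : ℕ) (a y : Fbar p) : (G₁ p q 1 a).eval y = 0 := by simp [G₁]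

theorem G₁_eval (q m : ℕ) (a y : Fbar p) :
    (G₁ p q m a).eval y =
      ∑ i ∈ Finset.range (m - 1), Aval p q a (m - 1 - i) ^ q ^ (i + 1) * y ^ q ^ i := by
  simp [G₁, eval_finsetSum]

theorem G₁_eval_succ (k : ℕ) (a y : Fbar p) (r : ℕ) :
    (G₁ p (p ^ k) (r + 2) a).eval y =
      (G₁ p (p ^ k) (r + 1) a).eval y ^ p ^ k + Aval p (p ^ k) a (r + 1) ^ p ^ k * y := by
  rw [G₁_eval, G₁_eval, show r + 2 - 1 = r + 1 from rfl, Nat.add_sub_cancel,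
    Finset.sum_range_succ', sum_pow_char_pow]
  congr 1
  · refine Finset.sum_congr rfl fun i _ => ?_
    rw [mul_pow, pow_frob_succ, pow_frob_succ, Nat.add_sub_add_right]
  · simp

/-- This is division of `z ^ q ^ (r + 1)` by `L`: the quotient is `G₁`, and `A`, `B` are the
coefficients of the remainder. -/
theorem G₁_eval_lin (k : ℕ) (a z : Fbar p) (r : ℕ) :
    (G₁ p (p ^ k) (r + 1) a).eval (lin (p ^ k) a z) =
      z ^ (p ^ k) ^ (r + 1) - Aval p (p ^ k) a (r + 1) * z ^ p ^ k
        - Bval p (p ^ k) a (r + 1) * z := by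
  induction r with
  | zero => simp [G₁_eval_one, Aval_one, Bval_one]
  | succ r ih =>
    rw [G₁_eval_succ, ih, Bval_succ, Aval_succ, sub_pow_expChar_pow, sub_pow_expChar_pow, mul_pow,
      mul_pow, pow_frob_succ, ← pow_mul z (p ^ k) (p ^ k), ← pow_two, lin]
    ring

theorem G₁_eval_zero (k m : ℕ) (a : Fbar p) : (G₁ p (p ^ k) m a).eval 0 = 0 := by
  have hp := (Fact.out : p.Prime).ne_zero
  simp [G₁_eval, hp]

/-! ### The case `A_m(a) = 0` -/

variable {k m : ℕ} {a : Fbar p}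

theorem pow_eq_Bval_mul (hm : 0 < m) (hA : Aval p (p ^ k) a m = 0) {z : Fbar p}
    (hz : lin (p ^ k) a z = 0) : z ^ (p ^ k) ^ m = Bval p (p ^ k) a m * z := by
  obtain ⟨r, rfl⟩ := Nat.exists_eq_add_of_lt hm
  rw [zero_add] at *
  have h := G₁_eval_lin k a z r
  rw [hz, G₁_eval_zero, hA] at h
  linear_combination -h

theorem pow_eq_self_of_artinSchreier (hk : 0 < k) (hm : 0 < m) (hA : Aval p (p ^ k) a m = 0)
    {x w : Fbar p} (hx0 : x ≠ 0) (hx : x ^ (p ^ k + 1) + x + a = 0)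
    (hw : x ^ (p ^ k + 1) * (w ^ p ^ k - w) ^ p ^ k = a * (w ^ p ^ k - w)) :
    w ^ (p ^ k) ^ m = w := by
  obtain ⟨z, hz0, hz⟩ := exists_pow_eq_mul hk hx0
  have h1 := pow_eq_Bval_mul hm hA (lin_eq_zero hx hz)
  have h2 : lin (p ^ k) a (w * z) = 0 := by rw [lin_mul hx hz, hw, sub_self, mul_zero]
  have h3 := pow_eq_Bval_mul hm hA h2
  rw [mul_pow] at h3
  have hzm : z ^ (p ^ k) ^ m ≠ 0 := pow_ne_zero _ hz0
  apply mul_right_cancel₀ hzm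
  rw [h3, h1]
  ring

theorem Bval_ne_zero (hk : 0 < k) (hm : 0 < m) (ha0 : a ≠ 0) (hA : Aval p (p ^ k) a m = 0) :
    Bval p (p ^ k) a m ≠ 0 := by
  obtain ⟨x, hx0, hx⟩ := exists_root_P hk ha0
  obtain ⟨z, hz0, hz⟩ := exists_pow_eq_mul hk hx0
  have h1 := pow_eq_Bval_mul hm hA (lin_eq_zero hx hz)
  intro hb
  rw [hb, zero_mul] at h1
  exact pow_ne_zero _ hz0 h1

/-- Since `a` is fixed by the `q ^ m`-power map, `b z = z ^ q ^ m` is again in `ker L`; this is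
`lin_mul` with `w = b`. -/
theorem artinSchreier_Bval (hm : 0 < m) (ham : a ^ (p ^ k) ^ m = a)
    (hA : Aval p (p ^ k) a m = 0) {x z : Fbar p} (hx : x ^ (p ^ k + 1) + x + a = 0) (hz0 : z ≠ 0)
    (hz : z ^ p ^ k = x * z) :
    x ^ (p ^ k + 1) * (Bval p (p ^ k) a m ^ p ^ k - Bval p (p ^ k) a m) ^ p ^ k =
      a * (Bval p (p ^ k) a m ^ p ^ k - Bval p (p ^ k) a m) := by
  have h0 := lin_eq_zero hx hz
  have h1 := pow_eq_Bval_mul hm hA h0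
  have h2 := lin_mul hx hz (Bval p (p ^ k) a m)
  rw [← h1, lin_pow_frob k ham, h0, zero_pow (pow_ne_zero _ (pow_ne_zero _
    (Fact.out : p.Prime).ne_zero)), eq_comm, mul_eq_zero] at h2
  exact sub_eq_zero.1 (h2.resolve_left hz0)

/-- If `b ^ q ≠ b`, the relation of `artinSchreier_Bval` determines `x ^ (q + 1)`, hence `x = -a - x
^ (q + 1)`, so all roots coincide. But `z` and `w z` with `w ^ q ≠ w` both lie in `ker L` and give
different roots. -/
theorem Bval_pow_eq_self (hk : 0 < k) (hm : 0 < m) (ha0 : a ≠ 0) (ham : a ^ (p ^ k) ^ m = a)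
    (hA : Aval p (p ^ k) a m = 0) : Bval p (p ^ k) a m ^ p ^ k = Bval p (p ^ k) a m := by
  obtain ⟨x, hx0, hx⟩ := exists_root_P hk ha0
  obtain ⟨z, hz0, hz⟩ := exists_pow_eq_mul hk hx0
  obtain ⟨D, hD0, hD⟩ := exists_artinSchreier_datum hk ha0 hx0
  obtain ⟨w, rfl⟩ := exists_pow_sub_eq hk D
  have hw0 : w ≠ 0 := by
    rintro rfl
    exact hD0 (by rw [zero_pow (pow_ne_zero _ (Fact.out : p.Prime).ne_zero), sub_zero])
  have hlin : lin (p ^ k) a (w * z) = 0 := by rw [lin_mul hx hz, hD, sub_self, mul_zero]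
  have hwz0 : w * z ≠ 0 := mul_ne_zero hw0 hz0
  obtain ⟨x', hx'⟩ : ∃ x', (w * z) ^ p ^ k = x' * (w * z) :=
    ⟨(w * z) ^ p ^ k / (w * z), by field_simp⟩
  have hx'root : x' ^ (p ^ k + 1) + x' + a = 0 := root_of_lin_eq_zero hwz0 hx' hlin
  have e1 := artinSchreier_Bval hm ham hA hx hz0 hz
  have e2 := artinSchreier_Bval hm ham hA hx'root hwz0 hx'
  by_contra hne
  have hne' : (Bval p (p ^ k) a m ^ p ^ k - Bval p (p ^ k) a m) ^ p ^ k ≠ 0 :=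
    pow_ne_zero _ (sub_ne_zero.2 hne)
  have hpow := mul_right_cancel₀ hne' (e1.trans e2.symm)
  have hxx : x = x' := by linear_combination hx - hx'root - hpow
  rw [mul_pow, hz, ← hxx] at hx'
  apply hD0
  rw [sub_eq_zero]
  apply mul_right_cancel₀ (mul_ne_zero hx0 hz0)
  linear_combination hx'

theorem lin_G₁_eval (hk : 0 < k) (hm : 0 < m) (ha0 : a ≠ 0) (ham : a ^ (p ^ k) ^ m = a)
    (hA : Aval p (p ^ k) a m = 0) (y : Fbar p) :
    lin (p ^ k) a ((G₁ p (p ^ k) m a).eval y) = y ^ (p ^ k) ^ m - Bval p (p ^ k) a m * y := by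
  obtain ⟨z, rfl⟩ := lin_surjective hk a y
  have hb := Bval_pow_eq_self hk hm ha0 ham hA
  obtain ⟨r, rfl⟩ := Nat.exists_eq_add_of_lt hm
  rw [zero_add] at *
  rw [G₁_eval_lin, hA, zero_mul, sub_zero, lin_sub, lin_pow_frob k ham,
    lin_mul_of_pow_eq_self k a hb]

end Linearized

/-! ### Descent from the closure to `GF p n` -/

section Descent

variable {p : ℕ} [Fact p.Prime] {n k : ℕ}

theorem pow_frob_div_gcd {x : Fbar p} (hx : x ∈ GF p n) :
    x ^ (p ^ k) ^ (n / n.gcd k) = x := by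
  rw [← pow_mul]
  refine mem_GF.1 (GF_le_of_dvd ?_ hx)
  rw [← Nat.mul_div_assoc _ (Nat.gcd_dvd_left n k), mul_comm k n,
    Nat.mul_div_assoc _ (Nat.gcd_dvd_right n k)]
  exact dvd_mul_right _ _

theorem sum_pow_frob_eq_self {m : ℕ} {y : Fbar p} (hy : y ^ (p ^ k) ^ m = y) :
    (∑ i ∈ Finset.range m, y ^ (p ^ k) ^ i) ^ p ^ k = ∑ i ∈ Finset.range m, y ^ (p ^ k) ^ i := by
  rw [sum_pow_char_pow]
  simp only [pow_frob_succ]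
  have h := Finset.sum_range_succ' (fun i => y ^ (p ^ k) ^ i) m
  rw [Finset.sum_range_succ, hy, pow_zero, pow_one] at h
  exact (add_right_cancel h).symm

/-- Additive Hilbert 90. -/
theorem exists_mem_GF_pow_sub_eq (hn : 0 < n) {w : Fbar p}
    (hw : w ^ (p ^ k) ^ (n / n.gcd k) = w) (hD : w ^ p ^ k - w ∈ GF p n) :
    ∃ u ∈ GF p n, u ^ p ^ k - u = w ^ p ^ k - w := by
  have hm : 0 < n / n.gcd k :=
    Nat.div_pos (Nat.gcd_le_left _ hn) (Nat.gcd_pos_of_pos_left _ hn)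
  obtain ⟨θ, hθ, ht⟩ := exists_sum_ne_zero (p := p) (k := k) hn le_rfl (fun _ => 1) hm one_ne_zero
  simp only [one_mul] at ht
  have hdiff (i : ℕ) : w ^ (p ^ k) ^ i - w ∈ GF p n := by
    induction i with
    | zero => simp
    | succ i ih =>
      have h := add_mem (pow_mem ih (p ^ k)) hD
      rwa [sub_pow_expChar_pow, pow_frob_succ, sub_add_sub_cancel] at h
  have htq := sum_pow_frob_eq_self (k := k) (pow_frob_div_gcd hθ)
  have hSq := sum_pow_frob_eq_self (k := k) (m := n / n.gcd k) (y := θ * w)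
    (by rw [mul_pow, hw, pow_frob_div_gcd hθ])
  have htmem : ∑ i ∈ Finset.range (n / n.gcd k), θ ^ (p ^ k) ^ i ∈ GF p n :=
    sum_mem fun i _ => pow_mem hθ _
  have hSmem : ∑ i ∈ Finset.range (n / n.gcd k), (θ * w) ^ (p ^ k) ^ i -
      (∑ i ∈ Finset.range (n / n.gcd k), θ ^ (p ^ k) ^ i) * w ∈ GF p n := by
    rw [Finset.sum_mul, ← Finset.sum_sub_distrib]
    refine sum_mem fun i _ => ?_
    rw [mul_pow, ← mul_sub]
    exact mul_mem (pow_mem hθ _) (hdiff i)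
  generalize ∑ i ∈ Finset.range (n / n.gcd k), θ ^ (p ^ k) ^ i = t at *
  generalize ∑ i ∈ Finset.range (n / n.gcd k), (θ * w) ^ (p ^ k) ^ i = S at *
  -- `S` and `t` are fixed by the `q`-power map, so subtracting `S / t` leaves `w ^ q - w`
  -- unchanged; `S - t w` in `F_Q` gives membership.
  refine ⟨w - S / t, ?_, ?_⟩
  · have h := neg_mem (div_mem hSmem htmem)
    convert h using 1
    field_simp
    ring
  · rw [sub_pow_expChar_pow, div_pow, htq, hSq]
    ring

/-- Multiplicative Hilbert 90. -/
theorem exists_mem_GF_pow_eq_mul (hn : 0 < n) {y c : Fbar p} (hy0 : y ≠ 0)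
    (hy : y ^ (p ^ k) ^ (n / n.gcd k) = y) (hc : c ∈ GF p n) (hyc : y ^ p ^ k = c * y) :
    ∃ u ∈ GF p n, u ≠ 0 ∧ u ^ p ^ k = c * u := by
  have hm : 0 < n / n.gcd k :=
    Nat.div_pos (Nat.gcd_le_left _ hn) (Nat.gcd_pos_of_pos_left _ hn)
  obtain ⟨θ, hθ, hS⟩ := exists_sum_ne_zero (p := p) (k := k) hn le_rfl
    (fun i => y ^ (p ^ k) ^ i) hm (pow_ne_zero _ hy0)
  simp only [← mul_pow] at hS
  have hquot (i : ℕ) : ∃ e ∈ GF p n, y ^ (p ^ k) ^ i = e * y := by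
    induction i with
    | zero => exact ⟨1, one_mem _, by simp⟩
    | succ i ih =>
      obtain ⟨e, he, hei⟩ := ih
      refine ⟨e ^ p ^ k * c, mul_mem (pow_mem he _) hc, ?_⟩
      rw [← pow_frob_succ, hei, mul_pow, hyc, mul_assoc]
  have hSq := sum_pow_frob_eq_self (k := k) (m := n / n.gcd k) (y := y * θ)
    (by rw [mul_pow, hy, pow_frob_div_gcd hθ])
  have hSmem : (∑ i ∈ Finset.range (n / n.gcd k), (y * θ) ^ (p ^ k) ^ i) / y ∈ GF p n := by
    rw [Finset.sum_div]
    refine sum_mem fun i _ => ?_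
    obtain ⟨e, he, hei⟩ := hquot i
    rw [mul_pow, hei, mul_right_comm, mul_div_cancel_right₀ _ hy0]
    exact mul_mem he (pow_mem hθ _)
  generalize ∑ i ∈ Finset.range (n / n.gcd k), (y * θ) ^ (p ^ k) ^ i = S at *
  -- `S` is a Lagrange resolvent: `S ^ q = S`, and `S / y` lies in `F_Q`.
  refine ⟨y / S, ?_, div_ne_zero hy0 hS, ?_⟩
  · have h := inv_mem hSmem
    rwa [inv_div] at h
  · rw [div_pow, hSq, hyc, mul_div_assoc]

/-! ### The roots of `P_a` in `GF p n` in terms of one of them -/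

theorem mem_rootsIn {q : ℕ} {a x : Fbar p} :
    x ∈ rootsIn n q a ↔ x ∈ GF p n ∧ x ^ (q + 1) + x + a = 0 := by
  simp [rootsIn, P]

theorem ne_zero_of_root {q : ℕ} {a x : Fbar p} (ha0 : a ≠ 0)
    (hx : x ^ (q + 1) + x + a = 0) : x ≠ 0 := by
  rintro rfl
  simp [ha0] at hx

theorem pow_pred_eq_iff {q : ℕ} (hq : 0 < q) {z c : Fbar p} (hz : z ≠ 0) :
    z ^ (q - 1) = c ↔ z ^ q = c * z := by
  obtain ⟨r, rfl⟩ := Nat.exists_eq_add_of_lt hq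
  rw [zero_add, Nat.add_sub_cancel, pow_succ]
  exact (mul_left_inj' hz).symm

theorem pow_pred_eq {q : ℕ} (hq : 0 < q) {w D : Fbar p} (hw0 : w ≠ 0) (hw : w ^ q - w = D) :
    w ^ (q - 1) = 1 + D / w := by
  rw [pow_pred_eq_iff hq hw0, add_mul, div_mul_cancel₀ _ hw0, ← hw]
  ring

variable {a x₀ β : Fbar p}

theorem exists_beta (hn : 0 < n) (hk : 0 < k) (ha : a ∈ GF p n) (ha0 : a ≠ 0)
    (hA : Aval p (p ^ k) a (n / n.gcd k) = 0) (hx : x₀ ∈ rootsIn n (p ^ k) a) :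
    ∃ β ∈ GF p n, β ^ (p ^ k - 1) = x₀ ^ 2 / a := by
  obtain ⟨hxm, hxr⟩ := mem_rootsIn.1 hx
  have hx0 := ne_zero_of_root ha0 hxr
  have hq : 0 < p ^ k := pow_pos (Fact.out : p.Prime).pos k
  have hm : 0 < n / n.gcd k :=
    Nat.div_pos (Nat.gcd_le_left _ hn) (Nat.gcd_pos_of_pos_left _ hn)
  obtain ⟨D, hD0, hD⟩ := exists_artinSchreier_datum hk ha0 hx0
  obtain ⟨w, hw⟩ := exists_pow_sub_eq hk D
  have hwm := pow_eq_self_of_artinSchreier hk hm hA hx0 hxr (by rw [hw, hD])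
  have hDm : D ^ (p ^ k) ^ (n / n.gcd k) = D := by
    rw [← hw, sub_pow_frob, pow_right_comm, hwm]
  have hDx0 : (D * x₀)⁻¹ ≠ 0 := inv_ne_zero (mul_ne_zero hD0 hx0)
  -- `(D x₀)⁻¹` already satisfies the equation for `β`, but only in the closure.
  obtain ⟨β, hβ, hβ0, hβq⟩ := exists_mem_GF_pow_eq_mul (k := k) hn hDx0
    (by rw [inv_pow, mul_pow, hDm, pow_frob_div_gcd hxm]) (div_mem (pow_mem hxm 2) ha) (by
      rw [inv_pow, mul_pow]
      have hxq : x₀ ^ p ^ k ≠ 0 := pow_ne_zero _ hx0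
      have hDq : D ^ p ^ k ≠ 0 := pow_ne_zero _ hD0
      rw [pow_succ] at hD
      field_simp
      linear_combination -hD)
  exact ⟨β, hβ, (pow_pred_eq_iff hq hβ0).2 hβq⟩

theorem ne_zero_of_pow_pred_eq (hk : 0 < k) (ha0 : a ≠ 0) (hx0 : x₀ ≠ 0)
    (hβ : β ^ (p ^ k - 1) = x₀ ^ 2 / a) : β ≠ 0 := by
  have hq : 1 < p ^ k := Nat.one_lt_pow hk.ne' (Fact.out : p.Prime).one_lt
  rintro rfl
  rw [zero_pow (by omega)] at hβ
  exact div_ne_zero (pow_ne_zero 2 hx0) ha0 hβ.symm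

theorem artinSchreier_datum_of_beta (hk : 0 < k) (ha0 : a ≠ 0) (hx0 : x₀ ≠ 0)
    (hβ : β ^ (p ^ k - 1) = x₀ ^ 2 / a) :
    x₀ ^ (p ^ k + 1) * (-(1 / (β * x₀))) ^ p ^ k = a * -(1 / (β * x₀)) := by
  have hq : 0 < p ^ k := pow_pos (Fact.out : p.Prime).pos k
  have hβ0 := ne_zero_of_pow_pred_eq hk ha0 hx0 hβ
  rw [pow_pred_eq_iff hq hβ0] at hβ
  have hxq : x₀ ^ p ^ k ≠ 0 := pow_ne_zero _ hx0
  rw [neg_pow_frob, div_pow, one_pow, mul_pow, hβ, pow_succ]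
  field_simp

theorem exists_artinSchreier_solution (hn : 0 < n) (hk : 0 < k) (ha0 : a ≠ 0)
    (hA : Aval p (p ^ k) a (n / n.gcd k) = 0) (hx : x₀ ∈ rootsIn n (p ^ k) a)
    (hβm : β ∈ GF p n) (hβ : β ^ (p ^ k - 1) = x₀ ^ 2 / a) :
    ∃ w ∈ GF p n, w ^ p ^ k - w + 1 / (β * x₀) = 0 := by
  obtain ⟨hxm, hxr⟩ := mem_rootsIn.1 hx
  have hx0 := ne_zero_of_root ha0 hxr
  have hm : 0 < n / n.gcd k :=
    Nat.div_pos (Nat.gcd_le_left _ hn) (Nat.gcd_pos_of_pos_left _ hn)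
  obtain ⟨w, hw⟩ := exists_pow_sub_eq hk (-(1 / (β * x₀)))
  have hwm := pow_eq_self_of_artinSchreier hk hm hA hx0 hxr
    (by rw [hw, artinSchreier_datum_of_beta hk ha0 hx0 hβ])
  obtain ⟨u, hu, huw⟩ := exists_mem_GF_pow_sub_eq (k := k) hn hwm
    (by rw [hw]; exact neg_mem (div_mem (one_mem _) (mul_mem hβm hxm)))
  exact ⟨u, hu, by rw [huw, hw, neg_add_cancel]⟩

theorem artinSchreier_solutions {w₀ c : Fbar p} (hw₀ : w₀ ∈ GF p n)
    (h : w₀ ^ p ^ k - w₀ + c = 0) :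
    {w : Fbar p | w ∈ GF p n ∧ w ^ p ^ k - w + c = 0} =
      (fun α => w₀ + α) '' (GF p (n.gcd k) : Set (Fbar p)) := by
  ext w
  constructor
  · rintro ⟨hw, hwc⟩
    refine ⟨w - w₀, mem_GF_gcd (sub_mem hw hw₀) (mem_GF.2 ?_), add_sub_cancel _ _⟩
    rw [sub_pow_expChar_pow]
    linear_combination hwc - h
  · rintro ⟨α, hα, rfl⟩
    refine ⟨add_mem hw₀ (GF_le_of_dvd (Nat.gcd_dvd_left n k) hα), ?_⟩
    have hαq := mem_GF.1 (GF_le_of_dvd (Nat.gcd_dvd_right n k) hα)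
    simp only [add_pow_expChar_pow, hαq]
    linear_combination h

theorem rootsIn_eq (hk : 0 < k) (ha0 : a ≠ 0) (hx : x₀ ∈ rootsIn n (p ^ k) a)
    (hβm : β ∈ GF p n) (hβ : β ^ (p ^ k - 1) = x₀ ^ 2 / a) {w₀ : Fbar p} (hw₀ : w₀ ∈ GF p n)
    (hw : w₀ ^ p ^ k - w₀ + 1 / (β * x₀) = 0) :
    rootsIn n (p ^ k) a =
      {x₀} ∪ {x | ∃ α ∈ GF p (n.gcd k), x = (w₀ + α) ^ (p ^ k - 1) * x₀} := by
  obtain ⟨hxm, hxr⟩ := mem_rootsIn.1 hx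
  have hx0 := ne_zero_of_root ha0 hxr
  have hq : 0 < p ^ k := pow_pos (Fact.out : p.Prime).pos k
  have hβ0 := ne_zero_of_pow_pred_eq hk ha0 hx0 hβ
  have hD := artinSchreier_datum_of_beta hk ha0 hx0 hβ
  have hsol := artinSchreier_solutions (k := k) hw₀ hw
  have hc0 : 1 / (β * x₀) ≠ 0 := one_div_ne_zero (mul_ne_zero hβ0 hx0)
  have hcm : 1 / (β * x₀) ∈ GF p n := div_mem (one_mem _) (mul_mem hβm hxm)
  generalize 1 / (β * x₀) = c at *
  obtain ⟨z, hz0, hz⟩ := exists_pow_eq_mul hk hx0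
  ext x
  constructor
  · intro hxx
    obtain ⟨hxm', hxr'⟩ := mem_rootsIn.1 hxx
    by_cases hne : x = x₀
    · exact Or.inl hne
    right
    have hx0' := ne_zero_of_root ha0 hxr'
    obtain ⟨v, hv0, hv⟩ := exists_pow_eq_mul hk (div_ne_zero hx0' hx0)
    have hquot : x / x₀ - 1 ≠ 0 := by
      rw [sub_ne_zero, Ne, div_eq_one_iff_eq hx0]; exact hne
    have hvD : v ^ p ^ k - v = (x / x₀ - 1) * v := by rw [hv]; ring
    have hD' : x₀ ^ (p ^ k + 1) * (v ^ p ^ k - v) ^ p ^ k = a * (v ^ p ^ k - v) := by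
      have h1 := lin_mul hxr hz v
      rw [lin_eq_zero hxr' (by rw [mul_pow, hv, hz]; field_simp), eq_comm, mul_eq_zero] at h1
      exact sub_eq_zero.1 (h1.resolve_left hz0)
    -- Numerator and denominator solve the same equation `x₀ ^ (q + 1) D ^ q = a D`, so `e` is in
    -- `F_q`, and `v / e` solves the normalized Artin–Schreier equation.
    set e := (v ^ p ^ k - v) / -c with he
    have he0 : e ≠ 0 := by
      rw [he, hvD]
      exact div_ne_zero (mul_ne_zero hquot hv0) (neg_ne_zero.2 hc0)
    have heq : e ^ p ^ k = e := by
      have hcq : (-c) ^ p ^ k ≠ 0 := pow_ne_zero _ (neg_ne_zero.2 hc0)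
      have hxq : x₀ ^ (p ^ k + 1) ≠ 0 := pow_ne_zero _ hx0
      rw [he, div_pow, div_eq_div_iff hcq (neg_ne_zero.2 hc0)]
      apply mul_left_cancel₀ (mul_ne_zero hxq ha0)
      linear_combination (a * -c) * hD' - (a * (v ^ p ^ k - v)) * hD
    have hwe : (v / e) ^ p ^ k - v / e = -c := by
      rw [div_pow, heq, ← sub_div, he, div_div_cancel₀]
      rw [hvD]
      exact mul_ne_zero hquot hv0
    have hmem : v / e ∈ GF p n := by
      have h1 : v / e = -c / (x / x₀ - 1) := by
        rw [eq_div_iff hquot, ← hwe, div_pow, heq, hv]; ring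
      rw [h1]
      exact div_mem (neg_mem hcm) (sub_mem (div_mem hxm' hxm) (one_mem _))
    have hin : v / e ∈ {w : Fbar p | w ∈ GF p n ∧ w ^ p ^ k - w + c = 0} :=
      ⟨hmem, by rw [hwe, neg_add_cancel]⟩
    rw [hsol] at hin
    obtain ⟨α, hα, hαe⟩ := hin
    refine ⟨α, hα, ?_⟩
    rw [show w₀ + α = v / e from hαe,
      (pow_pred_eq_iff (c := x / x₀) hq (div_ne_zero hv0 he0)).2 (by rw [div_pow, heq, hv]; ring)]
    field_simp
  · rintro (rfl | ⟨α, hα, rfl⟩)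
    · exact hx
    have hin : w₀ + α ∈ {w : Fbar p | w ∈ GF p n ∧ w ^ p ^ k - w + c = 0} := by
      rw [hsol]; exact ⟨α, hα, rfl⟩
    obtain ⟨hwm, hwc⟩ := hin
    generalize w₀ + α = w at *
    have hw0 : w ≠ 0 := by
      rintro rfl
      rw [zero_pow hq.ne', sub_zero, zero_add] at hwc
      exact hc0 hwc
    refine mem_rootsIn.2 ⟨mul_mem (pow_mem hwm _) hxm, ?_⟩
    refine root_of_lin_eq_zero (mul_ne_zero hw0 hz0) ?_ (z := w * z) ?_
    · rw [mul_pow, hz, (pow_pred_eq_iff hq hw0).1 rfl]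
      ring
    · rw [lin_mul hxr hz, show w ^ p ^ k - w = -c by linear_combination hwc, hD, sub_self,
        mul_zero]

theorem ncard_rootsIn (hn : 0 < n) (hk : 0 < k) (ha0 : a ≠ 0)
    (hx : x₀ ∈ rootsIn n (p ^ k) a) (hβm : β ∈ GF p n) (hβ : β ^ (p ^ k - 1) = x₀ ^ 2 / a)
    {w₀ : Fbar p} (hw₀ : w₀ ∈ GF p n) (hw : w₀ ^ p ^ k - w₀ + 1 / (β * x₀) = 0) :
    (rootsIn n (p ^ k) a).ncard = p ^ n.gcd k + 1 := by
  have hx0 := ne_zero_of_root ha0 (mem_rootsIn.1 hx).2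
  have hq : 0 < p ^ k := pow_pos (Fact.out : p.Prime).pos k
  have hd : 0 < n.gcd k := Nat.gcd_pos_of_pos_left _ hn
  have hc0 : 1 / (β * x₀) ≠ 0 :=
    one_div_ne_zero (mul_ne_zero (ne_zero_of_pow_pred_eq hk ha0 hx0 hβ) hx0)
  rw [rootsIn_eq hk ha0 hx hβm hβ hw₀ hw]
  have hsol := artinSchreier_solutions (k := k) hw₀ hw
  generalize 1 / (β * x₀) = c at *
  have hw0 : ∀ α ∈ GF p (n.gcd k), w₀ + α ≠ 0 ∧
      (w₀ + α) ^ (p ^ k - 1) = 1 + -c / (w₀ + α) := by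
    intro α hα
    have hin : w₀ + α ∈ {w : Fbar p | w ∈ GF p n ∧ w ^ p ^ k - w + c = 0} := by
      rw [hsol]; exact ⟨α, hα, rfl⟩
    have h0 : w₀ + α ≠ 0 := by
      intro h0
      have := hin.2
      rw [h0, zero_pow hq.ne', sub_zero, zero_add] at this
      exact hc0 this
    exact ⟨h0, pow_pred_eq hq h0 (by linear_combination hin.2)⟩
  have himg : {x | ∃ α ∈ GF p (n.gcd k), x = (w₀ + α) ^ (p ^ k - 1) * x₀} =
      (fun α => (w₀ + α) ^ (p ^ k - 1) * x₀) '' (GF p (n.gcd k) : Set (Fbar p)) := by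
    ext x
    simp [eq_comm]
  -- On solutions, `w ^ (q - 1) = 1 - c / w`, which recovers `w` and never equals `1`.
  have hinj : Set.InjOn (fun α => (w₀ + α) ^ (p ^ k - 1) * x₀)
      (GF p (n.gcd k) : Set (Fbar p)) := by
    intro α hα α' hα' h
    have h1 := mul_right_cancel₀ hx0 h
    rw [(hw0 α hα).2, (hw0 α' hα').2, add_right_inj,
      div_eq_div_iff (hw0 α hα).1 (hw0 α' hα').1] at h1
    exact (add_left_cancel (mul_left_cancel₀ (neg_ne_zero.2 hc0) h1)).symm
  rw [himg, Set.singleton_union, Set.ncard_insert_of_notMem _ ((finite_GF hd).image _),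
    hinj.ncard_image, ncard_GF hd]
  rintro ⟨α, hα, h⟩
  have h1 : (w₀ + α) ^ (p ^ k - 1) = 1 := mul_right_cancel₀ hx0 (h.trans (one_mul _).symm)
  rw [(hw0 α hα).2, add_eq_left] at h1
  exact div_ne_zero (neg_ne_zero.2 hc0) (hw0 α hα).1 h1

end Descent

/-! ### Nonzero elements of `rootSource` are roots of `P_a` in `GF p n` -/

section Source

variable {p : ℕ} [Fact p.Prime] {n k : ℕ} {a : Fbar p}

theorem Aval_mem_and_Bval_mem (ha : a ∈ GF p n) (r : ℕ) :
    Aval p (p ^ k) a (r + 1) ∈ GF p n ∧ Bval p (p ^ k) a (r + 1) ∈ GF p n := by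
  induction r with
  | zero => rw [zero_add, Aval_one, Bval_one]; exact ⟨one_mem _, zero_mem _⟩
  | succ r ih =>
    rw [Aval_succ, Bval_succ]
    exact ⟨sub_mem (pow_mem ih.2 _) (pow_mem ih.1 _), mul_mem (neg_mem ha) (pow_mem ih.1 _)⟩

theorem Aval_mem (ha : a ∈ GF p n) {r : ℕ} (hr : 0 < r) : Aval p (p ^ k) a r ∈ GF p n := by
  obtain ⟨r, rfl⟩ := Nat.exists_eq_add_of_lt hr
  rw [zero_add]
  exact (Aval_mem_and_Bval_mem ha r).1

theorem Bval_mem (ha : a ∈ GF p n) {r : ℕ} (hr : 0 < r) : Bval p (p ^ k) a r ∈ GF p n := by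
  obtain ⟨r, rfl⟩ := Nat.exists_eq_add_of_lt hr
  rw [zero_add]
  exact (Aval_mem_and_Bval_mem ha r).2

theorem G₂_eval (q d m : ℕ) (y : Fbar p) :
    (G₂ p q d m a).eval y =
      ∑ i ∈ Finset.range (p ^ d - 1), Bval p q a m ^ (p ^ d - 2 - i) * y ^ (q ^ m) ^ i := by
  simp [G₂, eval_finsetSum, pow_mul]

theorem pow_pow_eq_self {q : ℕ} {b : Fbar p} (hb : b ^ q = b) (i : ℕ) : b ^ q ^ i = b := by
  induction i with
  | zero => simp
  | succ i ih => rw [← pow_frob_succ, ih, hb]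

theorem G₂_eval_pow {d m : ℕ} (hbq : Bval p (p ^ k) a m ^ p ^ k = Bval p (p ^ k) a m)
    (hbd : Bval p (p ^ k) a m ^ (p ^ d - 1) = 1) {y : Fbar p}
    (hy : y ∈ GF p (k * (m * (p ^ d - 1)))) :
    (G₂ p (p ^ k) d m a).eval y ^ (p ^ k) ^ m =
      Bval p (p ^ k) a m * (G₂ p (p ^ k) d m a).eval y := by
  have hbm := pow_pow_eq_self hbq m
  rw [mem_GF, pow_mul, pow_mul] at hy
  rw [G₂_eval]
  generalize Bval p (p ^ k) a m = b at *
  rw [← sub_eq_zero, show (p ^ k) ^ m = p ^ (k * m) from (pow_mul _ _ _).symm, sum_pow_char_pow,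
    Finset.mul_sum, ← Finset.sum_sub_distrib]
  -- The defect telescopes; its end terms `y` and `b ^ (p ^ d - 1) y` cancel.
  have htel := Finset.sum_range_sub
    (fun i => b ^ (p ^ d - 1 - i) * y ^ ((p ^ k) ^ m) ^ i) (p ^ d - 1)
  rw [Nat.sub_self, pow_zero, one_mul, hy, Nat.sub_zero, hbd, one_mul, pow_zero, pow_one,
    sub_self] at htel
  rw [← htel]
  refine Finset.sum_congr rfl fun i hi => ?_
  rw [Finset.mem_range] at hi
  have h1 : p ^ d - 1 - (i + 1) = p ^ d - 2 - i := by omega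
  have h2 : p ^ d - 1 - i = p ^ d - 2 - i + 1 := by omega
  have h3 : (b ^ (p ^ d - 2 - i)) ^ (p ^ k) ^ m = b ^ (p ^ d - 2 - i) := by
    rw [pow_right_comm, hbm]
  rw [← pow_mul p k m] at h3
  rw [h1, h2, mul_pow, h3, ← pow_mul p k m, pow_frob_succ, pow_succ b]
  ring

theorem Bval_pow_gcd_sub_one (hn : 0 < n) (hk : 0 < k) (ha : a ∈ GF p n) (ha0 : a ≠ 0)
    (hA : Aval p (p ^ k) a (n / n.gcd k) = 0) :
    Bval p (p ^ k) a (n / n.gcd k) ^ (p ^ n.gcd k - 1) = 1 := by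
  have hm : 0 < n / n.gcd k :=
    Nat.div_pos (Nat.gcd_le_left _ hn) (Nat.gcd_pos_of_pos_left _ hn)
  have h1 := Bval_mem (k := k) ha hm
  have h2 := Bval_pow_eq_self hk hm ha0 (pow_frob_div_gcd ha) hA
  rw [pow_pred_eq_iff (pow_pos (Fact.out : p.Prime).pos _) (Bval_ne_zero hk hm ha0 hA), one_mul]
  exact mem_GF.1 (mem_GF_gcd h1 h2)

theorem rootSource_subset (hn : 0 < n) (hk : 0 < k) (ha : a ∈ GF p n) (ha0 : a ≠ 0)
    (hA : Aval p (p ^ k) a (n / n.gcd k) = 0) {x₀ : Fbar p} (hx : x₀ ∈ rootSource p n k a)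
    (hx0 : x₀ ≠ 0) : x₀ ∈ rootsIn n (p ^ k) a := by
  obtain ⟨y, hy, -, u, hu, hu0, v, hv, hv0, rfl⟩ := hx
  have hp := (Fact.out : p.Prime).one_lt
  have hm : 0 < n / n.gcd k :=
    Nat.div_pos (Nat.gcd_le_left _ hn) (Nat.gcd_pos_of_pos_left _ hn)
  have ham := pow_frob_div_gcd (k := k) ha
  have hbq := Bval_pow_eq_self hk hm ha0 ham hA
  have hbd := Bval_pow_gcd_sub_one hn hk ha ha0 hA
  have hq : 1 < p ^ k := Nat.one_lt_pow hk.ne' hp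
  have hQ : 1 < p ^ n := Nat.one_lt_pow hn.ne' hp
  have hqm : 0 < (p ^ k) ^ (n / n.gcd k) := by positivity
  have ht := G₂_eval_pow hbq hbd hy
  obtain ⟨c, hc⟩ := exists_sExp_eq hp hn hk
  set t := (G₂ p (p ^ k) (n.gcd k) (n / n.gcd k) a).eval y with htdef
  set b := Bval p (p ^ k) a (n / n.gcd k) with hbdef
  set T := t ^ sExp p n k * u * v with hT
  set z := (G₁ p (p ^ k) (n / n.gcd k) a).eval T with hzdef
  have hz0 : z ≠ 0 := by
    intro h
    rw [h, zero_pow (by omega)] at hx0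
    exact hx0 rfl
  have ht0 : t ≠ 0 := by
    intro h
    apply hz0
    rw [hzdef, hT, h, zero_pow (by omega), zero_mul, zero_mul, G₁_eval_zero]
  have hT0 : T ≠ 0 := mul_ne_zero (mul_ne_zero (pow_ne_zero _ ht0) hu0) hv0
  have hTm : T ^ (p ^ k) ^ (n / n.gcd k) = b * T := by
    rw [hT, mul_pow, mul_pow, pow_right_comm, ht, mul_pow b, pow_pow_eq_self (mem_GF.1 hu),
      pow_frob_div_gcd hv, hc, pow_succ b, pow_mul b, hbd, one_pow]
    ring
  have hlin : lin (p ^ k) a z = 0 := by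
    rw [hzdef, lin_G₁_eval hk hm ha0 ham hA, hTm, sub_self]
  have hTQ : (T ^ (p ^ n - 1)) ^ (p ^ k - 1) = 1 := by
    have htp : t ^ ((p ^ k) ^ (n / n.gcd k) - 1) = b := (pow_pred_eq_iff hqm ht0).2 ht
    have hup : u ^ (p ^ k - 1) = 1 :=
      (pow_pred_eq_iff (by omega) hu0).2 (by rw [one_mul]; exact hu)
    have hvp : v ^ (p ^ n - 1) = 1 :=
      (pow_pred_eq_iff (by omega) hv0).2 (by rw [one_mul]; exact hv)
    rw [← pow_mul, hT, mul_pow, mul_pow, ← pow_mul, sExp_mul, pow_mul, htp, hbd, pow_mul v, hvp,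
      one_pow, mul_comm (p ^ n - 1), pow_mul u, hup, one_pow, mul_one, mul_one]
  obtain ⟨e, he⟩ : ∃ e, e = T ^ (p ^ n - 1) := ⟨_, rfl⟩
  rw [← he] at hTQ
  have he0 : e ≠ 0 := by rw [he]; exact pow_ne_zero _ hT0
  have heT : T ^ p ^ n = e * T := (pow_pred_eq_iff (by omega) hT0).1 he.symm
  have heq : e ^ p ^ k = e := by
    rw [(pow_pred_eq_iff (by omega) he0).1 hTQ, one_mul]
  have hzQ : z ^ p ^ n = e * z := by
    rw [hzdef, G₁_eval, sum_pow_char_pow, Finset.mul_sum]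
    refine Finset.sum_congr rfl fun i hi => ?_
    rw [Finset.mem_range] at hi
    have hmem := Aval_mem (k := k) ha (show 0 < n / n.gcd k - 1 - i by omega)
    rw [mul_pow, mem_GF.1 (pow_mem hmem _), pow_right_comm T, heT, mul_pow, pow_pow_eq_self heq]
    ring
  refine mem_rootsIn.2 ⟨?_, root_of_lin_eq_zero hz0 ((pow_pred_eq_iff (by omega) hz0).1 rfl) hlin⟩
  rw [mem_GF, pow_right_comm, hzQ, mul_pow, hTQ, one_mul]

theorem exists_mem_rootSource (hn : 0 < n) (hk : 0 < k)
    (hA : Aval p (p ^ k) a (n / n.gcd k) = 0) : ∃ x₀ ∈ rootSource p n k a, x₀ ≠ 0 := by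
  have hp := (Fact.out : p.Prime).one_lt
  have hd : 0 < n.gcd k := Nat.gcd_pos_of_pos_left _ hn
  have hm : 0 < n / n.gcd k := Nat.div_pos (Nat.gcd_le_left _ hn) hd
  have hm1 : 1 < n / n.gcd k := by
    by_contra h
    rw [show n / n.gcd k = 1 by omega, Aval_one] at hA
    exact one_ne_zero hA
  have hP : 1 < p ^ n.gcd k := Nat.one_lt_pow hd.ne' hp
  have hM : 0 < p ^ n.gcd k - 1 := by omega
  set m := n / n.gcd k with hmdef
  set M := p ^ n.gcd k - 1 with hMdef
  -- The `q ^ m`-power map has order exactly `M` on `F_{q^N}`, so the `M` terms of `G₂` are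
  -- independent; its top coefficient is `b ^ 0 = 1`.
  have hsize : M ≤ k * (m * M) / (k * (m * M)).gcd (k * m) := by
    rw [← mul_assoc, Nat.gcd_mul_right_left, Nat.mul_div_cancel_left _ (by positivity)]
  obtain ⟨y, hy, hy0⟩ := exists_sum_ne_zero (p := p) (k := k * m) (by positivity) hsize
    (fun i => Bval p (p ^ k) a m ^ (p ^ n.gcd k - 2 - i)) (j := M - 1) (by omega) (by
      rw [show p ^ n.gcd k - 2 - (M - 1) = 0 by omega, pow_zero]; exact one_ne_zero)
  rw [pow_mul, ← G₂_eval] at hy0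
  set t := (G₂ p (p ^ k) (n.gcd k) m a).eval y with ht
  -- With `u = 1`, `G₁ (t ^ s v)` is a combination of `m - 1` independent powers of `v`; the top
  -- coefficient is nonzero since `A_1 = 1`.
  obtain ⟨v, hv, hv0⟩ := exists_sum_ne_zero (p := p) (k := k) (r := m - 1) hn (by omega)
    (fun i => Aval p (p ^ k) a (m - 1 - i) ^ (p ^ k) ^ (i + 1) *
      (t ^ sExp p n k * 1) ^ (p ^ k) ^ i) (j := m - 2) (by omega) (by
      rw [show m - 1 - (m - 2) = 1 by omega, Aval_one, one_pow, one_mul, mul_one]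
      exact pow_ne_zero _ (pow_ne_zero _ hy0))
  simp only [mul_assoc (Aval p _ _ _ ^ _), ← mul_pow] at hv0
  rw [← G₁_eval] at hv0
  refine ⟨_, ⟨y, hy, ?_, 1, one_mem _, one_ne_zero, v, hv, ?_, rfl⟩, pow_ne_zero _ hv0⟩
  · intro h
    apply hy0
    rw [ht, h, G₂_eval]
    exact Finset.sum_eq_zero fun i _ => by rw [zero_pow (by positivity), mul_zero]
  · rintro rfl
    rw [mul_zero, G₁_eval_zero] at hv0
    exact hv0 rfl

end Source

end BluherEq

theorem mainTheorem1 (p : ℕ) [Fact p.Prime] (n k d m q : ℕ) (hn : 0 < n) (hk : 0 < k)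
    (hd : d = Nat.gcd n k) (hm : m = n / d) (hq : q = p ^ k)
    (a : BluherEq.Fbar p) (ha : a ∈ BluherEq.GF p n) (ha0 : a ≠ 0)
    (hA : BluherEq.Aval p q a m = 0) :
    (BluherEq.rootsIn n q a).ncard = p ^ d + 1 ∧
    (∃ x₀ ∈ BluherEq.rootSource p n k a, x₀ ≠ 0) ∧
    ∀ x₀ ∈ BluherEq.rootSource p n k a, x₀ ≠ 0 →
      x₀ ∈ BluherEq.rootsIn n q a ∧
      (∃ β ∈ BluherEq.GF p n, β ^ (q - 1) = x₀ ^ 2 / a) ∧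
      ∀ β ∈ BluherEq.GF p n, β ^ (q - 1) = x₀ ^ 2 / a →
        {w : BluherEq.Fbar p | w ∈ BluherEq.GF p n ∧ w ^ q - w + 1 / (β * x₀) = 0}.ncard = p ^ d ∧
        ∀ w₀ ∈ BluherEq.GF p n, w₀ ^ q - w₀ + 1 / (β * x₀) = 0 →
          BluherEq.rootsIn n q a =
            {x₀} ∪ {x | ∃ α ∈ BluherEq.GF p d, x = (w₀ + α) ^ (q - 1) * x₀} := by
  subst hd hm hq
  obtain ⟨x₁, hx₁, hx₁0⟩ := BluherEq.exists_mem_rootSource hn hk hA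
  have hroot : ∀ x₀ ∈ BluherEq.rootSource p n k a, x₀ ≠ 0 → x₀ ∈ BluherEq.rootsIn n (p ^ k) a :=
    fun x₀ hx hx0 => BluherEq.rootSource_subset hn hk ha ha0 hA hx hx0
  refine ⟨?_, ⟨x₁, hx₁, hx₁0⟩, fun x₀ hx hx0 => ?_⟩
  · have hx := hroot x₁ hx₁ hx₁0
    obtain ⟨β, hβm, hβ⟩ := BluherEq.exists_beta hn hk ha ha0 hA hx
    obtain ⟨w, hwm, hw⟩ := BluherEq.exists_artinSchreier_solution hn hk ha0 hA hx hβm hβ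
    exact BluherEq.ncard_rootsIn hn hk ha0 hx hβm hβ hwm hw
  · have hx := hroot x₀ hx hx0
    refine ⟨hx, BluherEq.exists_beta hn hk ha ha0 hA hx, fun β hβm hβ => ⟨?_, fun w hwm hw =>
      BluherEq.rootsIn_eq hk ha0 hx hβm hβ hwm hw⟩⟩
    obtain ⟨w, hwm, hw⟩ := BluherEq.exists_artinSchreier_solution hn hk ha0 hA hx hβm hβ
    rw [BluherEq.artinSchreier_solutions hwm hw, (add_right_injective w).injOn.ncard_image,
      BluherEq.ncard_GF (Nat.gcd_pos_of_pos_left _ hn)]
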